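/- Let $d\ge 2$, $c>0$, $t>0$ and $a>0$. A particle starts at the origin of $\mathbb R^d$ and moves with constant speed $c$. It changes direction at the random instants $0<t_1<t_2<\cdots$, with waiting times $\tau_k=t_k-t_{k-1}$ ($t_0=0$), and moves in the direction $V_k$ between $t_{k-1}$ and $t_k$, where $V_1,V_2,\dots$ are independent, uniformly distributed on the unit sphere of $\mathbb R^d$, and independent of the waiting times. Let $\mathcal N(t)=\sup\{k\ge 1: t_k\le t\}$ (with $\mathcal N(t)=0$ if there is no such $k$) be the number of changes of direction up to time $t$, and let $X(t)\in\mathbb R^d$ be the position at time $t$; thus $X(t)=c\,(\tau_1V_1+(t-\tau_1)V_2)$ if $\mathcal N(t)=1$. Suppose that $P(\mathcal N(t)=1)>0$ and that, conditionally on $\mathcal N(t)=1$, the first waiting time $\tau_1$ has the generalized Dirichlet distribution with $n=1$ and $a_1=b_1=a$, that is, the rescaled Beta density $$\frac{\Gamma(2a)}{\Gamma(a)^2}\,\frac{\tau^{a-1}(t-\tau)^{a-1}}{t^{2a-1}},\qquad 0<\tau<t.$$ Then, conditionally on $\mathcal N(t)=1$, the law of $X(t)$ is absolutely continuous with respect to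 Lebesgue measure on $\mathbb R^d$, and it has the density $$p_1(x,t)=\frac{1}{2^{2a-d+1}\pi^{d/2}}\,\frac{\Gamma\left(\frac d2\right)\Gamma(2a)}{\Gamma(a)^2}\,\frac{(c^2t^2-\|x\|^2)^{\frac{d-3}{2}}}{(ct)^{2d-3}}\;{}_2F_1\left(d-1-a,\tfrac12,\tfrac d2;\frac{\|x\|^2}{c^2t^2}\right),\qquad \|x\|<ct,$$ and $p_1(x,t)=0$ for $\|x\|\ge ct$. Here, for $\gamma>\beta>0$ and $|z|<1$, $${}_2F_1(\alpha,\beta,\gamma;z)=\frac{\Gamma(\gamma)}{\Gamma(\beta)\Gamma(\gamma-\beta)}\int_0^1 s^{\beta-1}(1-s)^{\gamma-\beta-1}(1-sz)^{-\alpha}\,ds .$$ -/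

import Mathlib

open MeasureTheory ProbabilityTheory

noncomputable section

namespace RandomFlight

/-- The uniform distribution on the unit sphere of `ℝ^d` (normalised surface measure), as a
measure on `ℝ^d`. -/
def uniformSphere (d : ℕ) : Measure (EuclideanSpace ℝ (Fin d)) :=
  let σ : Measure (Metric.sphere (0 : EuclideanSpace ℝ (Fin d)) 1) :=
    (volume : Measure (EuclideanSpace ℝ (Fin d))).toSphere
  ((σ Set.univ)⁻¹ • σ).map Subtype.val

/-- The open simplex of all `(s₁, …, sₙ)` with `0 < s_k < t - ∑_{j < k} s_j` for every `k`. -/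
def openSimplex (n : ℕ) (t : ℝ) : Set (Fin n → ℝ) :=
  {s | ∀ k, 0 < s k ∧ s k < t - ∑ j ∈ Finset.Iio k, s j}

/-- The normalising constant of the rescaled generalised Dirichlet density. -/
def gdConst {n : ℕ} (a b : Fin n → ℝ) (t : ℝ) : ℝ :=
  1 / t ^ (∑ k, (a k + b k - 1)) *
    ∏ k, Real.Gamma (1 + ∑ j ∈ Finset.Ici k, (a j + b j - 1)) /
      (Real.Gamma (a k) * Real.Gamma (b k + ∑ j ∈ Finset.Ioi k, (a j + b j - 1)))

/-- The rescaled generalised Dirichlet density, as a function on the open simplex. -/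
def gdDensity {n : ℕ} (a b : Fin n → ℝ) (t : ℝ) (s : Fin n → ℝ) : ℝ :=
  gdConst a b t * ∏ k, (s k ^ (a k - 1) * (t - ∑ j ∈ Finset.Iic k, s j) ^ (b k - 1))

/-- The rescaled generalised Dirichlet distribution `GD(a; b)` at time `t`. -/
def gdLaw {n : ℕ} (a b : Fin n → ℝ) (t : ℝ) : Measure (Fin n → ℝ) :=
  volume.withDensity
    ((openSimplex n t).indicator fun s => ENNReal.ofReal (gdDensity a b t s))

/-- The instant `t_k = τ_1 + ⋯ + τ_k` of the `k`-th change of direction; the waiting time `τ_{j+1}`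
is stored as `τ j`. -/
def turnTime (τ : ℕ → ℝ) (k : ℕ) : ℝ := ∑ j ∈ Finset.range k, τ j

/-- The number `sup {k ≥ 1 : t_k ≤ t}` of changes of direction during `[0, t]`
(zero if there is none). -/
def numTurns (τ : ℕ → ℝ) (t : ℝ) : ℕ := sSup {k : ℕ | 1 ≤ k ∧ turnTime τ k ≤ t}

/-- The position at time `t` of a particle that starts at the origin, moves with speed `c`, and
takes the direction `v k` (that is, `V_{k+1}`) at the instant `t_k`: if there have been `n` changes
of direction, it is `c (∑_{k ≤ n} τ_k V_k + (t - t_n) V_{n+1})`. -/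
def position {d : ℕ} (c : ℝ) (v : ℕ → EuclideanSpace ℝ (Fin d)) (τ : ℕ → ℝ) (t : ℝ) :
    EuclideanSpace ℝ (Fin d) :=
  c • (∑ k ∈ Finset.range (numTurns τ t), τ k • v k
    + (t - turnTime τ (numTurns τ t)) • v (numTurns τ t))

/-- The directions `V` and the waiting times `τ` are those of a random flight in `ℝ^d` for which,
given `n` changes of direction up to time `t` (an event of positive probability), the first `n`
waiting times have the `GD(a; b)` distribution. -/
structure IsRandomFlight {Ω : Type*} [MeasurableSpace Ω] (P : Measure Ω) (d n : ℕ)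
    (a b : Fin n → ℝ) (t : ℝ) (V : ℕ → Ω → EuclideanSpace ℝ (Fin d)) (τ : ℕ → Ω → ℝ) :
    Prop where
  measurable_direction : ∀ k, Measurable (V k)
  measurable_waiting : ∀ k, Measurable (τ k)
  waiting_pos : ∀ᵐ ω ∂P, ∀ k, 0 < τ k ω
  direction_law : ∀ k, P.map (V k) = uniformSphere d
  direction_indep : iIndepFun V P
  direction_waiting_indep : IndepFun (fun ω k => V k ω) (fun ω k => τ k ω) P
  turns_prob_pos : 0 < P {ω | numTurns (fun k => τ k ω) t = n}
  waiting_law :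
    (P[|{ω | numTurns (fun k => τ k ω) t = n}]).map (fun ω (k : Fin n) => τ k ω) = gdLaw a b t

/-- The hypergeometric function `₂F₁(α, β, γ; z)` by its Euler integral
(for `γ > β > 0` and `|z| < 1`). -/
def hyp2F1 (α β γ z : ℝ) : ℝ :=
  Real.Gamma γ / (Real.Gamma β * Real.Gamma (γ - β)) *
    ∫ s in (0 : ℝ)..1, s ^ (β - 1) * (1 - s) ^ (γ - β - 1) * (1 - s * z) ^ (-α)

end RandomFlight

end

/-! Write `d = n + 1` and `R = c * t`. Given one turn, independence makes the law of the position
the image of `gdLaw` times two uniform laws on the sphere under `(τ, v, w) ↦ c (τ v + (t - τ) w)`.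
Both this law and the claimed one are finite and invariant under linear isometries, and such
measures are determined by the law of the norm (`ext_of_map_norm_eq`, by characteristic functions).
Only norms remain to be compared.

By the law of cosines the squared norm is `R² (1 - y W)` with `y = 4 τ (t - τ) / t²` and `W = (1 -
⟪v, w⟫) / 2`. These are independent: `y` is Beta(a, 1/2) (`lintegral_beta_symm`) and `W` is
Beta(n/2, n/2) (`lintegral_uniformSphere_apply_zero`). Fubini gives the density of `q = y W` as a
power weight times an Euler integral at `1 - q` (`lintegral_beta_mul_beta`), which is the
hypergeometric factor, since `1 - q = ‖x‖² / R²`. Polar coordinates and `q = 1 - r² / R²` bring the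
claimed density to the same form (`lintegral_norm_withDensity`).

Lower Lebesgue integrals are used almost throughout, so integrability matters only in converting the
real Euler integral. -/

open scoped ENNReal

namespace RandomFlight

/-! ### Polar coordinates for lower Lebesgue integrals. -/

section Polar

variable {E : Type*} [NormedAddCommGroup E] [NormedSpace ℝ E] [MeasurableSpace E] [BorelSpace E]
  [FiniteDimensional ℝ E] [Nontrivial E] (μ : Measure E) [μ.IsAddHaarMeasure]

theorem lintegral_polar {f : E → ℝ≥0∞} (hf : Measurable f) :
    ∫⁻ x, f x ∂μ = ∫⁻ v, (∫⁻ r in Set.Ioi (0 : ℝ),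
      ENNReal.ofReal (r ^ (Module.finrank ℝ E - 1)) * f (r • (v : E))) ∂μ.toSphere := by
  have hmp := μ.measurePreserving_homeomorphUnitSphereProd
  have hF : Measurable fun p : Metric.sphere (0 : E) 1 × Set.Ioi (0 : ℝ) => f (p.2.1 • p.1.1) := by
    fun_prop
  calc ∫⁻ x, f x ∂μ = ∫⁻ x : ({(0)}ᶜ : Set E), f x ∂(μ.comap (↑)) := by
        rw [lintegral_subtype_comap (measurableSet_singleton _).compl, restrict_compl_singleton]
    _ = ∫⁻ p, f (p.2.1 • p.1.1) ∂(μ.toSphere.prod (.volumeIoiPow (Module.finrank ℝ E - 1))) := by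
        rw [← hmp.lintegral_comp hF]
        refine lintegral_congr fun x => ?_
        have hx : ‖x.1‖ ≠ 0 := norm_ne_zero_iff.2 x.2
        simp [smul_smul, hx]
    _ = _ := by
        rw [lintegral_prod _ hF.aemeasurable]
        refine lintegral_congr fun v => ?_
        rw [Measure.volumeIoiPow, lintegral_withDensity_eq_lintegral_mul _ (by fun_prop)
          (by fun_prop)]
        exact lintegral_subtype_comap measurableSet_Ioi
          (fun r : ℝ => ENNReal.ofReal (r ^ (Module.finrank ℝ E - 1)) * f (r • (v : E)))

theorem lintegral_fun_norm {f : ℝ → ℝ≥0∞} (hf : Measurable f) :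
    ∫⁻ x, f ‖x‖ ∂μ = μ.toSphere Set.univ *
      ∫⁻ r in Set.Ioi (0 : ℝ), ENNReal.ofReal (r ^ (Module.finrank ℝ E - 1)) * f r := by
  rw [lintegral_polar μ (by fun_prop), mul_comm, ← lintegral_const]
  refine lintegral_congr fun v => setLIntegral_congr_fun measurableSet_Ioi fun r hr => ?_
  simp [norm_smul, abs_of_pos (show 0 < r from hr)]

theorem lintegral_pow_Ioo (n : ℕ) :
    ∫⁻ r in Set.Ioo (0 : ℝ) 1, ENNReal.ofReal (r ^ n) = ENNReal.ofReal (1 / (n + 1)) := by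
  rw [Measure.restrict_congr_set Ioo_ae_eq_Ioc,
    ← ofReal_integral_eq_lintegral_ofReal (intervalIntegral.intervalIntegrable_pow _).1,
    ← intervalIntegral.integral_of_le zero_le_one]
  · simp
  · filter_upwards [ae_restrict_mem measurableSet_Ioc] with y hy
    exact pow_nonneg hy.1.le _

theorem lintegral_pow_Ioo_ne_zero (n : ℕ) :
    ∫⁻ r in Set.Ioo (0 : ℝ) 1, ENNReal.ofReal (r ^ n) ≠ 0 := by
  rw [lintegral_pow_Ioo, Ne, ENNReal.ofReal_eq_zero, not_le]
  positivity

theorem lintegral_pow_Ioo_ne_top (n : ℕ) :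
    ∫⁻ r in Set.Ioo (0 : ℝ) 1, ENNReal.ofReal (r ^ n) ≠ ⊤ := by
  rw [lintegral_pow_Ioo]
  exact ENNReal.ofReal_ne_top

/-- Integral over the unit ball of a function that is constant on rays. -/
theorem lintegral_ball_normalize {g : E → ℝ≥0∞} (hg : Measurable g) :
    ∫⁻ x in Metric.ball (0 : E) 1, g (‖x‖⁻¹ • x) ∂μ =
      (∫⁻ v, g v ∂μ.toSphere) *
        ∫⁻ r in Set.Ioo (0 : ℝ) 1, ENNReal.ofReal (r ^ (Module.finrank ℝ E - 1)) := by
  have hm : Measurable fun x : E => g (‖x‖⁻¹ • x) := by fun_prop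
  rw [← lintegral_indicator measurableSet_ball, lintegral_polar μ (hm.indicator measurableSet_ball),
    ← lintegral_mul_const _ (by fun_prop)]
  refine lintegral_congr fun v => ?_
  rw [← lintegral_const_mul _ (by fun_prop), ← lintegral_indicator measurableSet_Ioi,
    ← lintegral_indicator measurableSet_Ioo]
  refine lintegral_congr fun r => ?_
  by_cases hr : 0 < r
  · by_cases hr1 : r < 1
    · simp [Set.indicator, norm_smul, abs_of_pos hr, hr, hr1, smul_smul, hr.ne', mul_comm]
    · simp [Set.indicator, norm_smul, abs_of_pos hr, hr1]
  · simp [Set.indicator, hr]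

end Polar

/-! ### Rotation invariance of surface measure. -/

section Rotation

variable {d : ℕ}

/-- A surface integral is, up to a nonzero finite radial factor, the integral of `g (x / ‖x‖)` over
the ball. Isometries preserve volume and the ball and commute with normalisation, so the factor
cancels. -/
theorem toSphere_map_linearIsometryEquiv [NeZero d]
    (ρ : EuclideanSpace ℝ (Fin d) ≃ₗᵢ[ℝ] EuclideanSpace ℝ (Fin d)) :
    (((volume : Measure (EuclideanSpace ℝ (Fin d))).toSphere).map Subtype.val).map ρ =
      ((volume : Measure (EuclideanSpace ℝ (Fin d))).toSphere).map Subtype.val := by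
  refine Measure.ext_of_lintegral _ fun g hg => ?_
  have hρ : Measurable ρ := ρ.continuous.measurable
  have hgρ : Measurable fun x => g (ρ x) := hg.comp hρ
  rw [lintegral_map hg hρ, lintegral_map hgρ measurable_subtype_coe,
    lintegral_map hg measurable_subtype_coe]
  refine (ENNReal.mul_left_inj (lintegral_pow_Ioo_ne_zero _) (lintegral_pow_Ioo_ne_top _)).1
    ((lintegral_ball_normalize volume hgρ).symm.trans
      (Eq.trans ?_ (lintegral_ball_normalize volume hg)))
  have h := ρ.measurePreserving.setLIntegral_comp_preimage
    (measurableSet_ball (x := (0 : EuclideanSpace ℝ (Fin d))) (ε := 1))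
    (f := fun x => g (‖x‖⁻¹ • x)) (by fun_prop)
  simpa [ρ.preimage_ball] using h

end Rotation

/-! ### Uniform directions and rotation-invariant measures. -/

section Uniform

variable {d : ℕ}

theorem uniformSphere_eq_smul : uniformSphere d =
    ((volume : Measure (EuclideanSpace ℝ (Fin d))).toSphere Set.univ)⁻¹ •
      ((volume : Measure (EuclideanSpace ℝ (Fin d))).toSphere).map Subtype.val := by
  simp only [uniformSphere, Measure.map_smul]

theorem toSphere_univ_ne_zero [NeZero d] :
    (volume : Measure (EuclideanSpace ℝ (Fin d))).toSphere Set.univ ≠ 0 :=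
  Measure.measure_univ_ne_zero.2 (Measure.toSphere_ne_zero _)

instance [NeZero d] : IsProbabilityMeasure (uniformSphere d) := by
  refine ⟨?_⟩
  rw [uniformSphere_eq_smul, Measure.smul_apply,
    Measure.map_apply measurable_subtype_coe .univ, Set.preimage_univ, smul_eq_mul,
    ENNReal.inv_mul_cancel toSphere_univ_ne_zero (measure_ne_top _ _)]

theorem ae_norm_uniformSphere : ∀ᵐ v ∂uniformSphere d, ‖v‖ = 1 := by
  rw [uniformSphere_eq_smul]
  refine Measure.ae_smul_measure ?_ _
  rw [ae_map_iff measurable_subtype_coe.aemeasurable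
    (measurableSet_eq_fun (by fun_prop) (by fun_prop))]
  exact .of_forall fun v => by simp

theorem uniformSphere_map [NeZero d]
    (ρ : EuclideanSpace ℝ (Fin d) ≃ₗᵢ[ℝ] EuclideanSpace ℝ (Fin d)) :
    (uniformSphere d).map ρ = uniformSphere d := by
  rw [uniformSphere_eq_smul, Measure.map_smul, toSphere_map_linearIsometryEquiv]

theorem exists_linearIsometryEquiv_apply_eq {x y : EuclideanSpace ℝ (Fin d)} (h : ‖x‖ = ‖y‖) :
    ∃ ρ : EuclideanSpace ℝ (Fin d) ≃ₗᵢ[ℝ] EuclideanSpace ℝ (Fin d), ρ x = y :=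
  ⟨_, Submodule.reflection_sub h⟩

theorem charFun_eq_of_norm_eq {μ : Measure (EuclideanSpace ℝ (Fin d))}
    (hμ : ∀ ρ : EuclideanSpace ℝ (Fin d) ≃ₗᵢ[ℝ] EuclideanSpace ℝ (Fin d), μ.map ρ = μ)
    {ξ η : EuclideanSpace ℝ (Fin d)} (h : ‖ξ‖ = ‖η‖) : charFun μ ξ = charFun μ η := by
  obtain ⟨ρ, rfl⟩ := exists_linearIsometryEquiv_apply_eq h
  conv_rhs => rw [← hμ ρ]
  rw [charFun_apply, charFun_apply, integral_map ρ.continuous.aemeasurable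
    (by fun_prop)]
  simp

/-- By invariance `charFun μ` is constant on spheres, so it may be averaged over directions. Fubini
then moves the average onto the uniform law, whose own characteristic function is radial; thus `μ`
enters only through the law of its norm. -/
theorem charFun_eq_integral_norm [NeZero d] {μ : Measure (EuclideanSpace ℝ (Fin d))}
    [IsFiniteMeasure μ]
    (hμ : ∀ ρ : EuclideanSpace ℝ (Fin d) ≃ₗᵢ[ℝ] EuclideanSpace ℝ (Fin d), μ.map ρ = μ)
    {e : EuclideanSpace ℝ (Fin d)} (he : ‖e‖ = 1) (ξ : EuclideanSpace ℝ (Fin d)) :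
    charFun μ ξ = ∫ r, charFun (uniformSphere d) ((‖ξ‖ * r) • e) ∂(μ.map norm) := by
  rw [integral_map (by fun_prop) (by fun_prop)]
  calc charFun μ ξ = ∫ v, charFun μ (‖ξ‖ • v) ∂uniformSphere d := by
        rw [integral_congr_ae (g := fun _ => charFun μ ξ)]
        · simp
        · filter_upwards [ae_norm_uniformSphere] with v hv
          exact charFun_eq_of_norm_eq hμ (by simp [norm_smul, hv])
    _ = ∫ x, charFun (uniformSphere d) (‖ξ‖ • x) ∂μ := by
        simp only [charFun_apply]
        rw [integral_integral_swap]
        · simp only [inner_smul_right, real_inner_comm]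
        · refine Integrable.of_bound (C := 1) (by fun_prop) (.of_forall fun p => ?_)
          simp [Function.uncurry, Complex.norm_exp]
    _ = _ := by
        refine integral_congr_ae (.of_forall fun x => ?_)
        exact charFun_eq_of_norm_eq uniformSphere_map (by simp [norm_smul, he])

theorem ext_of_map_norm_eq [NeZero d] {μ ν : Measure (EuclideanSpace ℝ (Fin d))}
    [IsFiniteMeasure μ] [IsFiniteMeasure ν]
    (hμ : ∀ ρ : EuclideanSpace ℝ (Fin d) ≃ₗᵢ[ℝ] EuclideanSpace ℝ (Fin d), μ.map ρ = μ)
    (hν : ∀ ρ : EuclideanSpace ℝ (Fin d) ≃ₗᵢ[ℝ] EuclideanSpace ℝ (Fin d), ν.map ρ = ν)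
    (h : μ.map norm = ν.map norm) : μ = ν := by
  obtain ⟨e, he⟩ := exists_norm_eq (EuclideanSpace ℝ (Fin d)) zero_le_one
  refine Measure.ext_of_charFun (funext fun ξ => ?_)
  rw [charFun_eq_integral_norm hμ he, charFun_eq_integral_norm hν he, h]

theorem withDensity_norm_map {f : ℝ → ℝ≥0∞} (hf : Measurable f)
    (ρ : EuclideanSpace ℝ (Fin d) ≃ₗᵢ[ℝ] EuclideanSpace ℝ (Fin d)) :
    (volume.withDensity fun x : EuclideanSpace ℝ (Fin d) => f ‖x‖).map ρ =
      volume.withDensity fun x => f ‖x‖ := by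
  refine Measure.ext_of_lintegral _ fun g hg => ?_
  have hρ : Measurable ρ := ρ.continuous.measurable
  have hgρ : Measurable fun x => g (ρ x) := hg.comp hρ
  rw [lintegral_map hg hρ, lintegral_withDensity_eq_lintegral_mul _ (by fun_prop) hg,
    lintegral_withDensity_eq_lintegral_mul _ (by fun_prop) hgρ,
    ← ρ.measurePreserving.lintegral_comp (f := (fun x => f ‖x‖) * g) (by fun_prop)]
  simp

/-- The law of the first coordinate of a point of the unit sphere, up to normalisation. -/
theorem lintegral_toSphere_apply_zero {n : ℕ} (hn : n ≠ 0) {g : ℝ → ℝ≥0∞} (hg : Measurable g) :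
    ∫⁻ v, g ((v : EuclideanSpace ℝ (Fin (n + 1))) 0)
        ∂(volume : Measure (EuclideanSpace ℝ (Fin (n + 1)))).toSphere =
      (volume : Measure (EuclideanSpace ℝ (Fin n))).toSphere Set.univ *
        ∫⁻ θ in Set.Ioo 0 Real.pi, ENNReal.ofReal (Real.sin θ ^ (n - 1)) * g (Real.cos θ) := by
  have : NeZero n := ⟨hn⟩
  -- The ball integrand depends on `x` only through its first coordinate and the norm of the others;
  -- `F` expresses it in this half-plane. `G` below adds the weight from polar coordinates in the
  -- remaining `n` variables.
  set F : ℝ × ℝ → ℝ≥0∞ := fun p =>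
    if √(p.1 ^ 2 + p.2 ^ 2) < 1 then g ((√(p.1 ^ 2 + p.2 ^ 2))⁻¹ * p.1) else 0 with hF
  have hFm : Measurable F :=
    Measurable.ite (measurableSet_lt (by fun_prop) (by fun_prop)) (by fun_prop) (by fun_prop)
  set G : ℝ × ℝ → ℝ≥0∞ := fun p =>
    if 0 < p.2 then ENNReal.ofReal (p.2 ^ (n - 1)) * F p else 0 with hG
  have hGm : Measurable G :=
    Measurable.ite (measurableSet_lt (by fun_prop) (by fun_prop)) (by fun_prop) (by fun_prop)
  refine (ENNReal.mul_left_inj (lintegral_pow_Ioo_ne_zero _) (lintegral_pow_Ioo_ne_top _)).1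
    ((lintegral_ball_normalize volume (g := fun x : EuclideanSpace ℝ (Fin (n + 1)) => g (x 0))
      (by fun_prop)).symm.trans ?_)
  calc ∫⁻ x in Metric.ball (0 : EuclideanSpace ℝ (Fin (n + 1))) 1, g ((‖x‖⁻¹ • x) 0)
      = ∫⁻ x : EuclideanSpace ℝ (Fin (n + 1)), F (x 0, ‖WithLp.toLp 2 (fun i : Fin n => x i.succ)‖) := by
        rw [← lintegral_indicator measurableSet_ball]
        refine lintegral_congr fun x => ?_
        have : √(x 0 ^ 2 + ‖WithLp.toLp 2 (fun i : Fin n => x i.succ)‖ ^ 2) = ‖x‖ := by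
          simp [EuclideanSpace.norm_eq, Fin.sum_univ_succ, Real.sq_sqrt, Finset.sum_nonneg, sq_nonneg]
        simp only [hF, this, Set.indicator, Metric.mem_ball, dist_zero_right]
        simp
    _ = ∫⁻ s : ℝ, ∫⁻ y : EuclideanSpace ℝ (Fin n), F (s, ‖y‖) := by
        rw [← (PiLp.volume_preserving_toLp (Fin (n + 1))).lintegral_comp (by fun_prop),
          ← (volume_preserving_piFinSuccAbove (fun _ => ℝ) 0).symm.lintegral_comp (by fun_prop),
          Measure.volume_eq_prod, lintegral_prod _ (by fun_prop)]
        refine lintegral_congr fun s => ?_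
        rw [← (PiLp.volume_preserving_toLp (Fin n)).lintegral_comp (by fun_prop)]
        refine lintegral_congr fun y => ?_
        simp
    _ = (volume : Measure (EuclideanSpace ℝ (Fin n))).toSphere Set.univ * ∫⁻ p, G p := by
        rw [Measure.volume_eq_prod, lintegral_prod _ hGm.aemeasurable,
          ← lintegral_const_mul _ (by fun_prop)]
        refine lintegral_congr fun s => ?_
        rw [lintegral_fun_norm volume (f := fun r => F (s, r)) (by fun_prop)]
        congr 1
        rw [← lintegral_indicator measurableSet_Ioi]
        simp [hG, Set.indicator]
    _ = _ := by
        rw [← lintegral_comp_polarCoord_symm, mul_assoc, mul_comm (lintegral _ _)]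
        congr 1
        rw [← lintegral_indicator measurableSet_Ioo, ← lintegral_indicator measurableSet_Ioo,
          ← lintegral_prod_mul (by fun_prop (disch := measurability))
            (by fun_prop (disch := measurability)), ← Measure.volume_eq_prod,
          ← lintegral_indicator polarCoord.open_target.measurableSet]
        refine lintegral_congr fun ⟨r, θ⟩ => ?_
        by_cases hr : 0 < r
        swap
        · simp [Set.indicator, hr]
        by_cases hθ : 0 < θ ∧ θ < Real.pi
        · have hθ' : -Real.pi < θ := by linarith [Real.pi_pos]
          have hs := Real.sin_pos_of_pos_of_lt_pi hθ.1 hθ.2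
          have hrs : 0 < r * Real.sin θ := mul_pos hr hs
          have hsq : √((r * Real.cos θ) ^ 2 + (r * Real.sin θ) ^ 2) = r := by
            rw [show (r * Real.cos θ) ^ 2 + (r * Real.sin θ) ^ 2 = r ^ 2 by
              linear_combination r ^ 2 * Real.sin_sq_add_cos_sq θ, Real.sqrt_sq hr.le]
          by_cases hr1 : r < 1
          · simp [Set.indicator, polarCoord, hF, hG, hr, hr1, hθ, hθ', hsq, hrs]
            obtain ⟨m, rfl⟩ := Nat.exists_eq_succ_of_ne_zero hn
            -- The planar Jacobian `r` and the weight `(r sin θ)^(n-1)` combine to `r^n sin^(n-1)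
            -- θ`, separating radius from angle.
            rw [inv_mul_cancel_left₀ hr.ne', ← mul_assoc, ← mul_assoc, ← ENNReal.ofReal_mul hr.le,
              ← ENNReal.ofReal_mul (by positivity)]
            congr 2
            simp only [Nat.succ_eq_add_one, Nat.add_sub_cancel]
            ring
          · simp [Set.indicator, polarCoord, hF, hG, hr, hr1, hθ, hθ', hsq]
        · by_cases hθ' : -Real.pi < θ ∧ θ < Real.pi
          · have hs : r * Real.sin θ ≤ 0 := mul_nonpos_of_nonneg_of_nonpos hr.le
              (Real.sin_nonpos_of_nonpos_of_neg_pi_le (by grind) hθ'.1.le)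
            simp [Set.indicator, polarCoord, hG, hθ, hs.not_gt]
          · simp [Set.indicator, polarCoord, hθ, hθ']

end Uniform

/-! ### One-dimensional changes of variable. -/

section Substitution

variable {a b α β : ℝ} {f f' : ℝ → ℝ}

theorem lintegral_Ioo_comp_of_deriv_pos (hab : a ≤ b) (hc : Continuous f)
    (hd : ∀ x ∈ Set.Ioo a b, HasDerivAt f (f' x) x) (hpos : ∀ x ∈ Set.Ioo a b, 0 < f' x)
    (hα : f a = α) (hβ : f b = β) (g : ℝ → ℝ≥0∞) :
    ∫⁻ x in Set.Ioo α β, g x = ∫⁻ x in Set.Ioo a b, ENNReal.ofReal (f' x) * g (f x) := by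
  subst hα hβ
  have hmono : StrictMonoOn f (Set.Icc a b) :=
    strictMonoOn_of_deriv_pos (convex_Icc a b) hc.continuousOn fun x hx => by
      rw [interior_Icc] at hx
      rw [(hd x hx).deriv]
      exact hpos x hx
  have himg : f '' Set.Ioo a b = Set.Ioo (f a) (f b) := by
    refine Set.Subset.antisymm ?_ (intermediate_value_Ioo hab hc.continuousOn)
    rintro _ ⟨x, hx, rfl⟩
    exact ⟨hmono (Set.left_mem_Icc.2 hab) (Set.Ioo_subset_Icc_self hx) hx.1,
      hmono (Set.Ioo_subset_Icc_self hx) (Set.right_mem_Icc.2 hab) hx.2⟩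
  rw [← himg, lintegral_image_eq_lintegral_abs_deriv_mul measurableSet_Ioo
    (fun x hx => (hd x hx).hasDerivWithinAt) (hmono.injOn.mono Set.Ioo_subset_Icc_self)]
  exact setLIntegral_congr_fun measurableSet_Ioo fun x hx => by
    simp only [abs_of_pos (hpos x hx)]

theorem lintegral_Ioo_comp_of_deriv_neg (hab : a ≤ b) (hc : Continuous f)
    (hd : ∀ x ∈ Set.Ioo a b, HasDerivAt f (-f' x) x) (hpos : ∀ x ∈ Set.Ioo a b, 0 < f' x)
    (hα : f a = α) (hβ : f b = β) (g : ℝ → ℝ≥0∞) :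
    ∫⁻ x in Set.Ioo β α, g x = ∫⁻ x in Set.Ioo a b, ENNReal.ofReal (f' x) * g (f x) := by
  have h := lintegral_Ioo_comp_of_deriv_pos (f := fun x => -f x) hab hc.neg
    (fun x hx => (hd x hx).neg.congr_deriv (neg_neg _)) hpos
    (congrArg _ hα) (congrArg _ hβ) (fun x => g (-x))
  simp only [neg_neg] at h
  rw [← h, ← (Measure.measurePreserving_neg (volume : Measure ℝ)).setLIntegral_comp_preimage_emb
    (MeasurableEquiv.neg ℝ).measurableEmbedding]
  simp

/-- Substitute `w = (1 - cos θ) / 2`, so that `w (1 - w) = (sin θ / 2)²` and `dw = (sin θ / 2) dθ`.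
-/
theorem lintegral_sin_pow_mul_cos {n : ℕ} (hn : n ≠ 0) (g : ℝ → ℝ≥0∞) :
    ∫⁻ θ in Set.Ioo 0 Real.pi, ENNReal.ofReal (Real.sin θ ^ (n - 1)) * g (Real.cos θ) =
      ENNReal.ofReal (2 ^ (n - 1)) * ∫⁻ w in Set.Ioo (0 : ℝ) 1,
        ENNReal.ofReal ((w * (1 - w)) ^ ((n : ℝ) / 2 - 1)) * g (1 - 2 * w) := by
  have h := lintegral_Ioo_comp_of_deriv_pos (f := fun θ => (1 - Real.cos θ) / 2)
    (f' := fun θ => Real.sin θ / 2) Real.pi_pos.le (by fun_prop)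
    (fun x _ => by simpa using ((Real.hasDerivAt_cos x).const_sub 1).div_const 2)
    (fun x hx => half_pos (Real.sin_pos_of_mem_Ioo hx))
    (show _ = 0 by simp) (show _ = 1 by simp)
    (fun w => ENNReal.ofReal ((w * (1 - w)) ^ ((n : ℝ) / 2 - 1)) * g (1 - 2 * w))
  rw [h, ← lintegral_const_mul' _ _ ENNReal.ofReal_ne_top]
  refine setLIntegral_congr_fun measurableSet_Ioo fun θ hθ => ?_
  have hs := Real.sin_pos_of_mem_Ioo hθ
  rw [← mul_assoc, ← mul_assoc, ← ENNReal.ofReal_mul (by positivity),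
    ← ENNReal.ofReal_mul (by positivity)]
  congr 2
  · obtain ⟨m, rfl⟩ := Nat.exists_eq_succ_of_ne_zero hn
    rw [show (1 - Real.cos θ) / 2 * (1 - (1 - Real.cos θ) / 2) = (Real.sin θ / 2) ^ (2 : ℝ) by
      rw [Real.rpow_two]; linear_combination (-1 / 4) * Real.sin_sq_add_cos_sq θ,
      ← Real.rpow_mul (by positivity), mul_sub, mul_div_cancel₀ _ two_ne_zero]
    rw [show ((m.succ : ℕ) : ℝ) - 2 * 1 = m - 1 by push_cast; ring,
      Real.rpow_sub_one (by positivity), Real.rpow_natCast, mul_assoc, mul_div_cancel₀ _ (half_pos hs).ne',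
      Nat.succ_sub_one, ← mul_pow, mul_div_cancel₀ _ two_ne_zero]
  · ring

/-- The map `τ ↦ 4 τ (t - τ) / t²` folds the interval at `t / 2`, and `1 - y = ((t - 2 τ) / t)²`
turns the Jacobian into the power `-1/2`. The two halves contribute equally, whence the factor `2`.
-/
theorem lintegral_beta_symm {a t : ℝ} (ht : 0 < t) (g : ℝ → ℝ≥0∞) :
    ENNReal.ofReal (t ^ (1 - 2 * a)) * ∫⁻ τ in Set.Ioo 0 t,
        ENNReal.ofReal (τ ^ (a - 1) * (t - τ) ^ (a - 1)) * g (4 * τ * (t - τ) / t ^ 2) =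
      ENNReal.ofReal (2 * 4 ^ (-a)) * ∫⁻ y in Set.Ioo (0 : ℝ) 1,
        ENNReal.ofReal (y ^ (a - 1) * (1 - y) ^ (-(1 / 2) : ℝ)) * g y := by
  set G : ℝ → ℝ≥0∞ := fun y => ENNReal.ofReal (y ^ (a - 1) * (1 - y) ^ (-(1 / 2) : ℝ)) * g y
  have hder : ∀ τ, HasDerivAt (fun τ => 4 * τ * (t - τ) / t ^ 2) (4 * (t - 2 * τ) / t ^ 2) τ := by
    intro τ
    have := ((((hasDerivAt_id τ).const_mul 4).mul ((hasDerivAt_id τ).const_sub t))).div_const (t ^ 2)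
    convert! this using 1
    simp; ring
  -- The midpoint is excluded because the Jacobian vanishes there; it is a null set.
  have key : ∀ τ ∈ Set.Ioo 0 t, τ ≠ t / 2 →
      ENNReal.ofReal (4 * |t - 2 * τ| / t ^ 2) * G (4 * τ * (t - τ) / t ^ 2) =
        ENNReal.ofReal (4 ^ a * t ^ (1 - 2 * a)) *
          (ENNReal.ofReal (τ ^ (a - 1) * (t - τ) ^ (a - 1)) * g (4 * τ * (t - τ) / t ^ 2)) := by
    intro τ hτ hne
    have h1 : 0 < τ := hτ.1
    have h2 : 0 < t - τ := sub_pos.2 hτ.2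
    have h3 : 0 < |t - 2 * τ| := abs_pos.2 fun h => hne (by linarith)
    simp only [G]
    rw [← mul_assoc, ← mul_assoc, ← ENNReal.ofReal_mul (by positivity),
      ← ENNReal.ofReal_mul (by positivity)]
    congr 2
    rw [show 1 - 4 * τ * (t - τ) / t ^ 2 = (|t - 2 * τ| / t) ^ (2 : ℝ) by
      rw [Real.rpow_two, div_pow, sq_abs]; field_simp; ring,
      ← Real.rpow_mul (by positivity), Real.div_rpow (by positivity) (by positivity),
      Real.mul_rpow (by positivity) (by positivity), Real.mul_rpow (by positivity) (by positivity),
      show (2 : ℝ) * -(1 / 2) = -1 by norm_num, Real.rpow_neg_one, ← Real.rpow_natCast t 2,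
      ← Real.rpow_mul ht.le, Real.rpow_sub_one (by norm_num : (4 : ℝ) ≠ 0),
      show 1 - 2 * a = 1 + -((2 : ℕ) * (a - 1)) - (2 : ℕ) by push_cast; ring,
      Real.rpow_sub ht, Real.rpow_add ht, Real.rpow_one, Real.rpow_neg ht.le]
    field_simp
  have hhalf : ∀ s ⊆ Set.Ioo 0 t, MeasurableSet s → (t / 2) ∉ s →
      (∫⁻ y in Set.Ioo (0 : ℝ) 1, G y =
        ∫⁻ τ in s, ENNReal.ofReal (4 * |t - 2 * τ| / t ^ 2) * G (4 * τ * (t - τ) / t ^ 2)) →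
      ENNReal.ofReal (4 ^ (-a)) * ∫⁻ y in Set.Ioo (0 : ℝ) 1, G y =
      ENNReal.ofReal (t ^ (1 - 2 * a)) * ∫⁻ τ in s,
        ENNReal.ofReal (τ ^ (a - 1) * (t - τ) ^ (a - 1)) * g (4 * τ * (t - τ) / t ^ 2) := by
    intro s hs hms hts h
    rw [h, setLIntegral_congr_fun hms fun τ hτ => key τ (hs hτ) (fun h => hts (h ▸ hτ)),
      lintegral_const_mul' _ _ ENNReal.ofReal_ne_top, ← mul_assoc,
      ← ENNReal.ofReal_mul (by positivity), ← mul_assoc, ← Real.rpow_add (by norm_num)]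
    simp
  have hfst := hhalf (Set.Ioo 0 (t / 2)) (Set.Ioo_subset_Ioo_right (by linarith))
    measurableSet_Ioo (by simp) <| by
      have h := lintegral_Ioo_comp_of_deriv_pos (a := 0) (b := t / 2) (α := 0) (β := 1)
        (f := fun τ => 4 * τ * (t - τ) / t ^ 2) (f' := fun τ => 4 * |t - 2 * τ| / t ^ 2)
        (by positivity) (by fun_prop)
        (fun τ hτ => by
          rw [abs_of_pos (by linarith [hτ.2])]; exact hder τ)
        (fun τ hτ => by
          have := abs_pos.2 (show t - 2 * τ ≠ 0 by linarith [hτ.2])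
          positivity) (by simp) (by field_simp; ring) G
      exact h
  have hsnd := hhalf (Set.Ioo (t / 2) t) (Set.Ioo_subset_Ioo_left (by linarith))
    measurableSet_Ioo (by simp) <| by
      have h := lintegral_Ioo_comp_of_deriv_neg (a := t / 2) (b := t) (α := 1) (β := 0)
        (f := fun τ => 4 * τ * (t - τ) / t ^ 2) (f' := fun τ => 4 * |t - 2 * τ| / t ^ 2)
        (by linarith) (by fun_prop)
        (fun τ hτ => by
          rw [abs_of_neg (by linarith [hτ.1])]
          convert hder τ using 1
          ring)
        (fun τ hτ => by
          have := abs_pos.2 (show t - 2 * τ ≠ 0 by linarith [hτ.1])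
          positivity) (by field_simp; ring) (by simp) G
      exact h
  rw [← Set.Ioo_union_Ico_eq_Ioo (half_pos ht) (half_lt_self ht).le,
    lintegral_union measurableSet_Ico (by
      rw [Set.disjoint_left]; exact fun x h1 h2 => h1.2.not_ge h2.1),
    Measure.restrict_congr_set (Ioo_ae_eq_Ico (μ := volume) (a := t / 2) (b := t)).symm, mul_add,
    ← hfst, ← hsnd, ENNReal.ofReal_mul zero_le_two, ENNReal.ofReal_ofNat, mul_assoc, two_mul]

end Substitution

/-! ### Radial, Beta and Euler integrals. -/

theorem lintegral_radial {n : ℕ} {R : ℝ} (hR : 0 < R) (K : ℝ → ℝ≥0∞) :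
    ∫⁻ r in Set.Ioo 0 R, ENNReal.ofReal
        (r ^ n * ((R ^ 2 - r ^ 2) ^ ((n : ℝ) / 2 - 1) / R ^ (2 * (n : ℝ) - 1))) *
          K (1 - r ^ 2 / R ^ 2) =
      ENNReal.ofReal (1 / 2) * ∫⁻ q in Set.Ioo (0 : ℝ) 1,
        ENNReal.ofReal (q ^ ((n : ℝ) / 2 - 1) * (1 - q) ^ ((n : ℝ) / 2 - 1 / 2)) * K q := by
  have h := lintegral_Ioo_comp_of_deriv_neg (f := fun r => 1 - r ^ 2 / R ^ 2)
    (f' := fun r => 2 * r / R ^ 2) hR.le (by fun_prop)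
    (fun x _ => by simpa using ((hasDerivAt_pow 2 x).div_const (R ^ 2)).const_sub 1)
    (fun x hx => by have := hx.1; positivity) (show _ = 1 by simp)
    (show _ = 0 by field_simp; simp)
    (fun q => ENNReal.ofReal (q ^ ((n : ℝ) / 2 - 1) * (1 - q) ^ ((n : ℝ) / 2 - 1 / 2)) * K q)
  rw [h, ← lintegral_const_mul' _ _ ENNReal.ofReal_ne_top]
  refine setLIntegral_congr_fun measurableSet_Ioo fun r hr => ?_
  have h0 : 0 < r := hr.1
  have h1 : 0 < R ^ 2 - r ^ 2 := by nlinarith [hr.1, hr.2]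
  rw [← mul_assoc, ← mul_assoc, ← ENNReal.ofReal_mul (by positivity),
    ← ENNReal.ofReal_mul (by positivity)]
  congr 2
  rw [show 1 - (1 - r ^ 2 / R ^ 2) = (r / R) ^ (2 : ℝ) by rw [Real.rpow_two, div_pow]; ring,
    show 1 - r ^ 2 / R ^ 2 = (R ^ 2 - r ^ 2) / R ^ 2 by field_simp,
    ← Real.rpow_mul (by positivity), Real.div_rpow h1.le (by positivity), ← Real.rpow_natCast R 2,
    ← Real.rpow_mul hR.le, Real.div_rpow h0.le hR.le,
    show (2 : ℝ) * ((n : ℝ) / 2 - 1 / 2) = n - 1 by ring, Real.rpow_sub_one h0.ne',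
    show (2 : ℕ) * ((n : ℝ) / 2 - 1) = n - 2 by push_cast; ring, Real.rpow_natCast r n,
    show 2 * (n : ℝ) - 1 = (n - 2) + (n - 1) + (2 : ℕ) by push_cast; ring,
    Real.rpow_add hR, Real.rpow_add hR]
  field_simp

theorem integrableOn_beta {u v : ℝ} (hu : 0 < u) (hv : 0 < v) :
    IntegrableOn (fun s : ℝ => s ^ (u - 1) * (1 - s) ^ (v - 1)) (Set.Ioo 0 1) := by
  have h := (Complex.betaIntegral_convergent (u := u) (v := v) (by simpa) (by simpa)).1.norm
  refine IntegrableOn.congr_fun (IntegrableOn.mono_set h Set.Ioo_subset_Ioc_self) (fun s hs => ?_)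
    measurableSet_Ioo
  have h1 : (0 : ℝ) < 1 - s := sub_pos.2 hs.2
  have h2 : (1 - s : ℂ) = ((1 - s : ℝ) : ℂ) := by push_cast; rfl
  simp only [norm_mul]
  rw [h2, Complex.norm_cpow_eq_rpow_re_of_pos hs.1, Complex.norm_cpow_eq_rpow_re_of_pos h1]
  simp

/-- Since `z < 1`, the last factor is continuous, hence bounded, on `[0, 1]` whatever the sign of
`α`; the integrand is thus dominated by a Beta integrand, and the Bochner integral is a genuine one.
-/
theorem ofReal_eulerIntegral {α u v z : ℝ} (hu : 0 < u) (hv : 0 < v) (hz0 : 0 ≤ z) (hz1 : z < 1) :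
    ENNReal.ofReal (∫ s in (0 : ℝ)..1, s ^ (u - 1) * (1 - s) ^ (v - 1) * (1 - s * z) ^ (-α)) =
      ∫⁻ s in Set.Ioo (0 : ℝ) 1,
        ENNReal.ofReal (s ^ (u - 1) * (1 - s) ^ (v - 1) * (1 - s * z) ^ (-α)) := by
  have hpos : ∀ s ∈ Set.Icc (0 : ℝ) 1, 0 < 1 - s * z := fun s hs => by nlinarith [hs.1, hs.2]
  have hcont : ContinuousOn (fun s : ℝ => (1 - s * z) ^ (-α)) (Set.Icc 0 1) :=
    ContinuousOn.rpow_const (by fun_prop) fun s hs => Or.inl (hpos s hs).ne'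
  rw [intervalIntegral.integral_of_le zero_le_one, integral_Ioc_eq_integral_Ioo]
  refine ofReal_integral_eq_lintegral_ofReal ?_ ?_
  · obtain ⟨C, hC⟩ := isCompact_Icc.exists_bound_of_continuousOn hcont
    refine Integrable.mul_bdd (c := C) (integrableOn_beta hu hv)
      (Measurable.aestronglyMeasurable (by fun_prop)) ?_
    filter_upwards [ae_restrict_mem measurableSet_Ioo] with s hs
    exact hC s (Set.Ioo_subset_Icc_self hs)
  · filter_upwards [ae_restrict_mem measurableSet_Ioo] with s hs
    have := hpos s (Set.Ioo_subset_Icc_self hs)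
    have h1 : (0 : ℝ) < 1 - s := sub_pos.2 hs.2
    have h2 := hs.1
    simp only [Pi.zero_apply]
    positivity

/-- The density of a product of independent `Beta(a, 1/2)` and `Beta(b, b)` variables. -/
theorem lintegral_beta_mul_beta {a b : ℝ} {h : ℝ → ℝ≥0∞} (hh : Measurable h) :
    ∫⁻ y in Set.Ioo (0 : ℝ) 1, ENNReal.ofReal (y ^ (a - 1) * (1 - y) ^ (-(1 / 2) : ℝ)) *
        ∫⁻ w in Set.Ioo (0 : ℝ) 1, ENNReal.ofReal ((w * (1 - w)) ^ (b - 1)) * h (y * w) =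
      ∫⁻ q in Set.Ioo (0 : ℝ) 1, ENNReal.ofReal (q ^ (b - 1) * (1 - q) ^ (b - 1 / 2)) *
        ((∫⁻ s in Set.Ioo (0 : ℝ) 1, ENNReal.ofReal
          (s ^ (-(1 / 2) : ℝ) * (1 - s) ^ (b - 1) * (1 - s * (1 - q)) ^ (a - 2 * b))) * h q) := by
  -- The integrand in the variables `y` and `q = y w`: the exponent `a - 2b` is `(a - 1) - 2(b - 1)
  -- - 1`, the last `-1` from `dw = dq / y`. Extending by zero outside the triangle allows Fubini on
  -- the whole plane.
  set J : ℝ → ℝ → ℝ≥0∞ := fun y q => if 0 < q ∧ q < y ∧ y < 1 then ENNReal.ofReal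
    (y ^ (a - 2 * b) * (1 - y) ^ (-(1 / 2) : ℝ) * (q ^ (b - 1) * (y - q) ^ (b - 1))) * h q else 0
    with hJ
  have hJm : Measurable (Function.uncurry J) := by
    refine Measurable.ite ?_ (by fun_prop) (by fun_prop)
    exact (measurableSet_lt measurable_const measurable_snd).inter
      ((measurableSet_lt measurable_snd measurable_fst).inter
        (measurableSet_lt measurable_fst measurable_const))
  calc _ = ∫⁻ y, ∫⁻ q, J y q := by
        rw [← lintegral_indicator measurableSet_Ioo]
        refine lintegral_congr fun y => ?_
        by_cases hy : 0 < y ∧ y < 1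
        swap
        · have : ∀ q, J y q = 0 := fun q => if_neg fun hq => hy ⟨hq.1.trans hq.2.1, hq.2.2⟩
          simp [this, Set.indicator, hy]
        have hy0 := hy.1
        have hy1 : 0 < 1 - y := sub_pos.2 hy.2
        have hsub := lintegral_Ioo_comp_of_deriv_pos (a := 0) (b := 1) (f := fun w => y * w)
          (f' := fun _ => y) zero_le_one (by fun_prop)
          (fun x _ => by simpa using (hasDerivAt_id x).const_mul y) (fun _ _ => hy0)
          (mul_zero y) (mul_one y) (J y)
        have hsupp : ∫⁻ q, J y q = ∫⁻ q in Set.Ioo 0 y, J y q := by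
          rw [← lintegral_indicator measurableSet_Ioo]
          refine lintegral_congr fun q => ?_
          by_cases hq : 0 < q ∧ q < y
          · simp [Set.indicator, hq]
          · have : J y q = 0 := if_neg fun h' => hq ⟨h'.1, h'.2.1⟩
            simp [this, Set.indicator]
        rw [hsupp, hsub, Set.indicator_of_mem (show y ∈ Set.Ioo 0 1 from hy),
          ← lintegral_const_mul' _ _ ENNReal.ofReal_ne_top]
        refine setLIntegral_congr_fun measurableSet_Ioo fun w hw => ?_
        have hw0 := hw.1
        have hw1 : 0 < 1 - w := sub_pos.2 hw.2
        have hyw : y * w < y := by nlinarith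
        simp only [hJ]
        rw [if_pos ⟨by positivity, hyw, hy.2⟩, ← mul_assoc, ← mul_assoc,
          ← ENNReal.ofReal_mul (by positivity), ← ENNReal.ofReal_mul (by positivity)]
        congr 2
        rw [show y - y * w = y * (1 - w) by ring, Real.mul_rpow hw0.le hw1.le,
          Real.mul_rpow hy0.le hw0.le, Real.mul_rpow hy0.le hw1.le,
          show a - 1 = (a - 2 * b) + (b - 1) + (b - 1) + 1 by ring, Real.rpow_add_one hy0.ne',
          Real.rpow_add hy0, Real.rpow_add hy0]
        ring
    _ = ∫⁻ q, ∫⁻ y, J y q := lintegral_lintegral_swap hJm.aemeasurable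
    _ = _ := by
        rw [← lintegral_indicator measurableSet_Ioo]
        refine lintegral_congr fun q => ?_
        by_cases hq : 0 < q ∧ q < 1
        swap
        · have : ∀ y, J y q = 0 := fun y => if_neg fun hy => hq ⟨hy.1, hy.2.1.trans hy.2.2⟩
          simp [this, Set.indicator, hq]
        have hq0 := hq.1
        have hq1 : 0 < 1 - q := sub_pos.2 hq.2
        -- For fixed `q`, the substitution `y = 1 - s (1 - q)` carries `(0, 1)` onto `(q, 1)` and
        -- turns `y ^ (a - 2b)` into the Euler factor with `z = 1 - q`.
        have hsub := lintegral_Ioo_comp_of_deriv_neg (a := 0) (b := 1)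
          (f := fun s => 1 - s * (1 - q)) (f' := fun _ => 1 - q) zero_le_one (by fun_prop)
          (fun x _ => by simpa using ((hasDerivAt_id x).mul_const (1 - q)).const_sub 1)
          (fun _ _ => hq1) (show _ = 1 by simp) (show _ = q by simp) (fun y => J y q)
        have hsupp : ∫⁻ y, J y q = ∫⁻ y in Set.Ioo q 1, J y q := by
          rw [← lintegral_indicator measurableSet_Ioo]
          refine lintegral_congr fun y => ?_
          by_cases hy : q < y ∧ y < 1
          · simp [Set.indicator, hy]
          · have : J y q = 0 := if_neg fun h' => hy h'.2
            simp [this, Set.indicator]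
        rw [hsupp, hsub, Set.indicator_of_mem (show q ∈ Set.Ioo 0 1 from hq), ← mul_assoc,
          ← lintegral_const_mul' _ _ ENNReal.ofReal_ne_top, ← lintegral_mul_const _ (by fun_prop)]
        refine setLIntegral_congr_fun measurableSet_Ioo fun s hs => ?_
        have hs0 := hs.1
        have hs1 : 0 < 1 - s := sub_pos.2 hs.2
        have hy0 : 0 < 1 - s * (1 - q) := by nlinarith
        have hyq : q < 1 - s * (1 - q) := by nlinarith
        have hy1 : 1 - s * (1 - q) < 1 := by nlinarith
        simp only [hJ]
        rw [if_pos ⟨hq0, hyq, hy1⟩, ← mul_assoc]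
        rw [← ENNReal.ofReal_mul hq1.le, ← ENNReal.ofReal_mul (by positivity)]
        congr 2
        rw [show 1 - (1 - s * (1 - q)) = s * (1 - q) by ring,
          show 1 - s * (1 - q) - q = (1 - s) * (1 - q) by ring, Real.mul_rpow hs0.le hq1.le,
          Real.mul_rpow hs1.le hq1.le,
          show b - 1 / 2 = -(1 / 2) + (b - 1) + 1 by ring, Real.rpow_add_one hq1.ne',
          Real.rpow_add hq1]
        ring

/-! ### The event of exactly one turn, and conditioning on it. -/

theorem numTurns_eq_one_iff {x : ℕ → ℝ} {t : ℝ} :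
    numTurns x t = 1 ↔ turnTime x 1 ≤ t ∧ ∀ k, 2 ≤ k → t < turnTime x k := by
  unfold numTurns
  constructor
  · intro h
    -- On `ℕ`, `sSup` is `0` for unbounded and for empty sets, so the value `1` rules out both.
    have hb : BddAbove {k : ℕ | 1 ≤ k ∧ turnTime x k ≤ t} := by
      by_contra hb
      rw [Nat.sSup_of_not_bddAbove hb] at h
      exact zero_ne_one h
    have hne : {k : ℕ | 1 ≤ k ∧ turnTime x k ≤ t}.Nonempty := by
      by_contra hne
      rw [Set.not_nonempty_iff_eq_empty.1 hne] at h
      simp at h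
    refine ⟨(h ▸ Nat.sSup_mem hne hb).2, fun k hk => ?_⟩
    by_contra hle
    have := le_csSup hb ⟨by omega, not_lt.1 hle⟩
    omega
  · rintro ⟨h1, h2⟩
    have : {k : ℕ | 1 ≤ k ∧ turnTime x k ≤ t} = {1} := by
      ext k
      constructor
      · rintro ⟨hk, hkt⟩
        by_contra hk1
        exact (h2 k (by have : k ≠ 1 := hk1; omega)).not_ge hkt
      · rintro rfl
        exact ⟨le_rfl, h1⟩
    rw [this, csSup_singleton]

theorem measurableSet_numTurns_eq_one (t : ℝ) :
    MeasurableSet {x : ℕ → ℝ | numTurns x t = 1} := by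
  have hm : ∀ k, Measurable fun x : ℕ → ℝ => turnTime x k := fun k => by
    unfold turnTime
    fun_prop
  simp only [numTurns_eq_one_iff, Set.ofPred_and, Set.ofPred_forall]
  exact (measurableSet_le (hm 1) measurable_const).inter
    (.iInter fun k => .iInter fun _ => measurableSet_lt measurable_const (hm k))

theorem position_of_numTurns_eq_one {d : ℕ} {c t : ℝ} {v : ℕ → EuclideanSpace ℝ (Fin d)}
    {x : ℕ → ℝ} (h : numTurns x t = 1) :
    position c v x t = c • (x 0 • v 0 + (t - x 0) • v 1) := by
  simp [position, h, turnTime]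

/-- Conditioning on an event determined by `Y` leaves the law of `X` unchanged and keeps `X`
independent of `Y`. Here `Y` is the sequence of waiting times and `X` that of directions. -/
theorem map_cond_prodMk_of_indepFun {Ω α β γ δ : Type*} [MeasurableSpace Ω] [MeasurableSpace α]
    [MeasurableSpace β] [MeasurableSpace γ] [MeasurableSpace δ] {P : Measure Ω}
    [IsFiniteMeasure P] {X : Ω → α} {Y : Ω → β} (hX : Measurable X) (hY : Measurable Y)
    (h : IndepFun X Y P) {A : Set β} (hA : MeasurableSet A) {f : β → γ} (hf : Measurable f)
    {g : α → δ} (hg : Measurable g) :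
    (P[|Y ⁻¹' A]).map (fun ω => (f (Y ω), g (X ω))) =
      ((P[|Y ⁻¹' A]).map (f ∘ Y)).prod (P.map (g ∘ X)) := by
  symm
  refine Measure.prod_eq fun s u hs hu => ?_
  have hYA := hY hA
  rw [Measure.map_apply (by fun_prop) (hs.prod hu), Measure.map_apply (by fun_prop) hs,
    Measure.map_apply (by fun_prop) hu, cond_apply hYA, cond_apply hYA, mul_assoc]
  congr 1
  have := h.measure_inter_preimage_eq_mul (g ⁻¹' u) (A ∩ f ⁻¹' s) (hg hu) (hA.inter (hf hs))
  rw [mul_comm]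
  convert this using 2
  · ext ω
    simp only [Set.mem_inter_iff, Set.mem_preimage, Set.mem_prod]
    tauto
  · rfl
  · rfl

section Flight

variable {Ω : Type*} [MeasurableSpace Ω] {P : Measure Ω} [IsProbabilityMeasure P] {d : ℕ}
  {a t : ℝ} {V : ℕ → Ω → EuclideanSpace ℝ (Fin d)} {τ : ℕ → Ω → ℝ}

theorem IsRandomFlight.map_position (h : IsRandomFlight P d 1 (fun _ => a) (fun _ => a) t V τ)
    (c : ℝ) :
    (P[|{ω | numTurns (fun k => τ k ω) t = 1}]).map
        (fun ω => position c (fun k => V k ω) (fun k => τ k ω) t) =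
      (((gdLaw (fun _ : Fin 1 => a) (fun _ => a) t).map fun s => s 0).prod
        ((uniformSphere d).prod (uniformSphere d))).map
          fun p => c • (p.1 • p.2.1 + (t - p.1) • p.2.2) := by
  have hV := h.measurable_direction
  have hτ := h.measurable_waiting
  have hVm : Measurable fun ω k => V k ω := measurable_pi_iff.2 hV
  have hτm : Measurable fun ω k => τ k ω := measurable_pi_iff.2 hτ
  have hA := measurableSet_numTurns_eq_one t
  have hVV : P.map (fun ω => (V 0 ω, V 1 ω)) = (uniformSphere d).prod (uniformSphere d) := by
    rw [(indepFun_iff_map_prod_eq_prod_map_map (hV 0).aemeasurable (hV 1).aemeasurable).1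
      (h.direction_indep.indepFun zero_ne_one), h.direction_law, h.direction_law]
  have hjoint := map_cond_prodMk_of_indepFun hVm hτm h.direction_waiting_indep hA
    (f := fun x => x 0) (measurable_pi_apply 0) (g := fun v => (v 0, v 1)) (by fun_prop)
  rw [show P.map ((fun v : ℕ → EuclideanSpace ℝ (Fin d) => (v 0, v 1)) ∘ fun ω k => V k ω) = _
    from hVV] at hjoint
  rw [← h.waiting_law, Measure.map_map (by fun_prop) (by fun_prop)]
  have hE : MeasurableSet {ω | numTurns (fun k => τ k ω) t = 1} := hτm hA
  refine Eq.trans ?_ (congrArg (Measure.map _) hjoint)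
  rw [Measure.map_map (by fun_prop) (by fun_prop)]
  refine Measure.map_congr ?_
  filter_upwards [ae_cond_mem hE] with ω hω
  exact position_of_numTurns_eq_one hω

end Flight

/-! ### The law of the norm of the position. -/

theorem gdDensity_one (a t : ℝ) (s : Fin 1 → ℝ) :
    gdDensity (fun _ => a) (fun _ => a) t s =
      1 / t ^ (a + a - 1) * (Real.Gamma (2 * a) / (Real.Gamma a * Real.Gamma a)) *
        (s 0 ^ (a - 1) * (t - s 0) ^ (a - 1)) := by
  have h3 : Finset.Iic (0 : Fin 1) = {0} := rfl
  simp [gdDensity, gdConst, h3, two_mul]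

theorem mem_openSimplex_one {t : ℝ} {s : Fin 1 → ℝ} : s ∈ openSimplex 1 t ↔ s 0 ∈ Set.Ioo 0 t := by
  have h : Finset.Iio (0 : Fin 1) = ∅ := rfl
  simp [openSimplex, h]

theorem lintegral_gdLaw_one {a t : ℝ} (ha : 0 < a) (ht : 0 < t) {g : ℝ → ℝ≥0∞}
    (hg : Measurable g) :
    ∫⁻ s, g (s 0) ∂gdLaw (fun _ : Fin 1 => a) (fun _ => a) t =
      ENNReal.ofReal (Real.Gamma (2 * a) / Real.Gamma a ^ 2) *
        (ENNReal.ofReal (t ^ (1 - 2 * a)) * ∫⁻ τ in Set.Ioo 0 t,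
          ENNReal.ofReal (τ ^ (a - 1) * (t - τ) ^ (a - 1)) * g τ) := by
  have hΓ : 0 ≤ Real.Gamma (2 * a) / Real.Gamma a ^ 2 :=
    div_nonneg (Real.Gamma_pos_of_pos (by positivity)).le (sq_nonneg _)
  have hdens : ((openSimplex 1 t).indicator fun s =>
      ENNReal.ofReal (gdDensity (fun _ => a) (fun _ => a) t s)) = fun s =>
      (Set.Ioo 0 t).indicator (fun τ => ENNReal.ofReal (Real.Gamma (2 * a) / Real.Gamma a ^ 2 *
        t ^ (1 - 2 * a) * (τ ^ (a - 1) * (t - τ) ^ (a - 1)))) (s 0) := by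
    ext s
    simp only [Set.indicator, mem_openSimplex_one, gdDensity_one]
    rw [show (1 : ℝ) - 2 * a = -(a + a - 1) by ring, Real.rpow_neg ht.le]
    congr 3
    ring
  have hm : Measurable ((Set.Ioo 0 t).indicator fun τ => ENNReal.ofReal
      (Real.Gamma (2 * a) / Real.Gamma a ^ 2 * t ^ (1 - 2 * a) *
        (τ ^ (a - 1) * (t - τ) ^ (a - 1)))) :=
    Measurable.indicator (by fun_prop) measurableSet_Ioo
  rw [gdLaw, hdens, lintegral_withDensity_eq_lintegral_mul _ (by fun_prop) (by fun_prop),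
    ← mul_assoc, ← ENNReal.ofReal_mul hΓ, ← lintegral_const_mul' _ _ ENNReal.ofReal_ne_top,
    ← lintegral_indicator measurableSet_Ioo]
  refine ((volume_preserving_funUnique (Fin 1) ℝ).lintegral_comp (hm.mul hg)).trans
    (lintegral_congr fun τ => ?_)
  by_cases hτ : τ ∈ Set.Ioo 0 t
  · simp only [Pi.mul_apply, Set.indicator_of_mem hτ]
    rw [ENNReal.ofReal_mul (by positivity), mul_assoc]
  · simp [Set.indicator_of_notMem hτ]

theorem toSphere_univ_eq {d : ℕ} (hd : d ≠ 0) :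
    (volume : Measure (EuclideanSpace ℝ (Fin d))).toSphere Set.univ =
      ENNReal.ofReal (2 * Real.pi ^ ((d : ℝ) / 2) / Real.Gamma ((d : ℝ) / 2)) := by
  have : NeZero d := ⟨hd⟩
  have hd' : (0 : ℝ) < d := by positivity
  rw [Measure.toSphere_apply_univ, EuclideanSpace.volume_ball, finrank_euclideanSpace_fin,
    Fintype.card_fin, ENNReal.ofReal_one, one_pow, one_mul, ← ENNReal.ofReal_natCast,
    ← ENNReal.ofReal_mul hd'.le]
  congr 1
  rw [Real.Gamma_add_one (by positivity), Real.sqrt_eq_rpow, ← Real.rpow_natCast,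
    ← Real.rpow_mul Real.pi_pos.le, show (1 / 2 : ℝ) * d = d / 2 by ring]
  have := Real.Gamma_pos_of_pos (half_pos hd')
  field_simp

/-- The normalising constant of the law of `(1 - ⟪e, V⟫) / 2`, for `V` uniform on the sphere. -/
noncomputable def axialConst (n : ℕ) : ℝ :=
  Real.Gamma (((n + 1 : ℕ) : ℝ) / 2) / (√Real.pi * Real.Gamma ((n : ℝ) / 2)) * 2 ^ (n - 1)

theorem lintegral_uniformSphere_apply_zero {n : ℕ} (hn : n ≠ 0) {g : ℝ → ℝ≥0∞}
    (hg : Measurable g) :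
    ∫⁻ v, g (v 0) ∂uniformSphere (n + 1) = ENNReal.ofReal (axialConst n) *
      ∫⁻ w in Set.Ioo (0 : ℝ) 1,
        ENNReal.ofReal ((w * (1 - w)) ^ ((n : ℝ) / 2 - 1)) * g (1 - 2 * w) := by
  have h1 := Real.Gamma_pos_of_pos (show 0 < ((n + 1 : ℕ) : ℝ) / 2 by positivity)
  have h2 := Real.Gamma_pos_of_pos (show 0 < (n : ℝ) / 2 by positivity)
  rw [uniformSphere_eq_smul, lintegral_smul_measure, lintegral_map (by fun_prop)
    measurable_subtype_coe, lintegral_toSphere_apply_zero hn hg, lintegral_sin_pow_mul_cos hn,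
    toSphere_univ_eq n.succ_ne_zero, toSphere_univ_eq hn, smul_eq_mul,
    ← ENNReal.ofReal_inv_of_pos (by positivity), ← mul_assoc, ← mul_assoc,
    ← ENNReal.ofReal_mul (by positivity), ← ENNReal.ofReal_mul (by positivity)]
  congr 2
  rw [axialConst, show ((n + 1 : ℕ) : ℝ) / 2 = n / 2 + 1 / 2 by push_cast; ring,
    Real.rpow_add Real.pi_pos, ← Real.sqrt_eq_rpow]
  field_simp

/-- Rotating `v` to the first basis vector leaves the uniform law unchanged, so the law of cosines
involves only the coordinate `w 0`. With `w 0 = 1 - 2w` the sum of squares is `t² (1 - y w)`, where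
`y = 4 τ (t - τ) / t²`. -/
theorem lintegral_norm_two_steps {n : ℕ} (hn : n ≠ 0) {c t τ : ℝ} (hc : 0 < c) (ht : 0 < t)
    {v : EuclideanSpace ℝ (Fin (n + 1))} (hv : ‖v‖ = 1) {h : ℝ → ℝ≥0∞} (hh : Measurable h) :
    ∫⁻ w, h ‖c • (τ • v + (t - τ) • w)‖ ∂uniformSphere (n + 1) =
      ENNReal.ofReal (axialConst n) * ∫⁻ w in Set.Ioo (0 : ℝ) 1,
        ENNReal.ofReal ((w * (1 - w)) ^ ((n : ℝ) / 2 - 1)) *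
          h (c * t * √(1 - 4 * τ * (t - τ) / t ^ 2 * w)) := by
  set e : EuclideanSpace ℝ (Fin (n + 1)) := EuclideanSpace.single 0 1 with he
  obtain ⟨ρ, rfl⟩ := exists_linearIsometryEquiv_apply_eq (x := e) (y := v) (by simp [he, hv])
  have hρ : Measurable ρ := ρ.continuous.measurable
  rw [← uniformSphere_map ρ, lintegral_map (by fun_prop) hρ]
  have hnorm : ∀ᵐ w ∂uniformSphere (n + 1), h ‖c • (τ • ρ e + (t - τ) • ρ w)‖ =
      h (c * √(τ ^ 2 + (t - τ) ^ 2 + 2 * τ * (t - τ) * w 0)) := by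
    filter_upwards [ae_norm_uniformSphere] with w hw
    congr 1
    rw [← map_smul, ← map_smul, ← map_add, norm_smul, LinearIsometryEquiv.norm_map,
      Real.norm_of_nonneg hc.le]
    congr 1
    rw [← Real.sqrt_sq (norm_nonneg (τ • e + (t - τ) • w)), norm_add_sq_real, norm_smul, norm_smul,
      real_inner_smul_left, real_inner_smul_right, he, EuclideanSpace.inner_single_left, hw]
    congr 1
    simp
    ring
  rw [lintegral_congr_ae hnorm, lintegral_uniformSphere_apply_zero hn
    (g := fun u => h (c * √(τ ^ 2 + (t - τ) ^ 2 + 2 * τ * (t - τ) * u))) (by fun_prop)]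
  congr 1
  refine lintegral_congr fun w => ?_
  congr 2
  rw [mul_assoc c, show τ ^ 2 + (t - τ) ^ 2 + 2 * τ * (t - τ) * (1 - 2 * w) =
    t ^ 2 * (1 - 4 * τ * (t - τ) / t ^ 2 * w) by field_simp; ring,
    Real.sqrt_mul (sq_nonneg t), Real.sqrt_sq ht.le]

/-- The Euler integral of `₂F₁(α, 1/2, γ; z)` with `γ - 1/2 = b`. -/
noncomputable def eulerLIntegral (α b z : ℝ) : ℝ≥0∞ :=
  ∫⁻ s in Set.Ioo (0 : ℝ) 1,
    ENNReal.ofReal (s ^ (-(1 / 2) : ℝ) * (1 - s) ^ (b - 1) * (1 - s * z) ^ (-α))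

theorem measurable_eulerLIntegral (α b : ℝ) : Measurable (eulerLIntegral α b) := by
  unfold eulerLIntegral
  exact Measurable.lintegral_prod_right (by fun_prop)

theorem ofReal_hyp2F1 {α γ z : ℝ} (hγ : 1 / 2 < γ) (hz0 : 0 ≤ z) (hz1 : z < 1) :
    ENNReal.ofReal (hyp2F1 α (1 / 2) γ z) =
      ENNReal.ofReal (Real.Gamma γ / (√Real.pi * Real.Gamma (γ - 1 / 2))) *
        eulerLIntegral α (γ - 1 / 2) z := by
  have h1 := Real.Gamma_pos_of_pos (show 0 < γ by linarith)
  have h2 := Real.Gamma_pos_of_pos (show 0 < γ - 1 / 2 by linarith)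
  rw [hyp2F1, Real.Gamma_one_half_eq, ENNReal.ofReal_mul (by positivity),
    ofReal_eulerIntegral (by norm_num) (by linarith) hz0 hz1]
  norm_num [eulerLIntegral]

theorem lintegral_norm_position_law {n : ℕ} (hn : n ≠ 0) {a c t : ℝ} (ha : 0 < a) (hc : 0 < c)
    (ht : 0 < t) [SFinite (gdLaw (fun _ : Fin 1 => a) (fun _ => a) t)] {h : ℝ → ℝ≥0∞}
    (hh : Measurable h) :
    ∫⁻ x, h ‖x‖ ∂((((gdLaw (fun _ : Fin 1 => a) (fun _ => a) t).map fun s => s 0).prod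
        ((uniformSphere (n + 1)).prod (uniformSphere (n + 1)))).map
          fun p => c • (p.1 • p.2.1 + (t - p.1) • p.2.2)) =
      ENNReal.ofReal (Real.Gamma (2 * a) / Real.Gamma a ^ 2 * (2 * 4 ^ (-a)) * axialConst n) *
        ∫⁻ q in Set.Ioo (0 : ℝ) 1,
          ENNReal.ofReal (q ^ ((n : ℝ) / 2 - 1) * (1 - q) ^ ((n : ℝ) / 2 - 1 / 2)) *
            (eulerLIntegral (n - a) (n / 2) (1 - q) * h (c * t * √(1 - q))) := by
  have hΓ : 0 ≤ Real.Gamma (2 * a) / Real.Gamma a ^ 2 :=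
    div_nonneg (Real.Gamma_pos_of_pos (by positivity)).le (sq_nonneg _)
  set Φ : ℝ → ℝ≥0∞ := fun y => ENNReal.ofReal (axialConst n) * ∫⁻ w in Set.Ioo (0 : ℝ) 1,
    ENNReal.ofReal ((w * (1 - w)) ^ ((n : ℝ) / 2 - 1)) * h (c * t * √(1 - y * w))
  have hΦm : Measurable Φ := Measurable.const_mul (Measurable.lintegral_prod_right (by fun_prop)) _
  calc _ = ∫⁻ s, Φ (4 * s 0 * (t - s 0) / t ^ 2) ∂gdLaw (fun _ : Fin 1 => a) (fun _ => a) t := by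
        rw [lintegral_map (by fun_prop) (by fun_prop), lintegral_prod _ (by fun_prop),
          lintegral_map (Measurable.lintegral_prod_right (by fun_prop)) (by fun_prop)]
        refine lintegral_congr fun s => ?_
        rw [lintegral_prod _ (by fun_prop),
          lintegral_congr_ae (g := fun _ => Φ (4 * s 0 * (t - s 0) / t ^ 2))]
        · simp
        · filter_upwards [ae_norm_uniformSphere] with v hv
          exact lintegral_norm_two_steps hn hc ht hv hh
    _ = ENNReal.ofReal (Real.Gamma (2 * a) / Real.Gamma a ^ 2) *
        (ENNReal.ofReal (2 * 4 ^ (-a)) * ∫⁻ y in Set.Ioo (0 : ℝ) 1,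
          ENNReal.ofReal (y ^ (a - 1) * (1 - y) ^ (-(1 / 2) : ℝ)) * Φ y) := by
        rw [lintegral_gdLaw_one ha ht (g := fun τ => Φ (4 * τ * (t - τ) / t ^ 2)) (by fun_prop),
          lintegral_beta_symm ht]
    _ = _ := by
        have hcomm : ∀ y : ℝ, ENNReal.ofReal (y ^ (a - 1) * (1 - y) ^ (-(1 / 2) : ℝ)) * Φ y =
            ENNReal.ofReal (axialConst n) *
              (ENNReal.ofReal (y ^ (a - 1) * (1 - y) ^ (-(1 / 2) : ℝ)) *
                ∫⁻ w in Set.Ioo (0 : ℝ) 1, ENNReal.ofReal ((w * (1 - w)) ^ ((n : ℝ) / 2 - 1)) *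
                  h (c * t * √(1 - y * w))) := fun y => mul_left_comm _ _ _
        simp only [hcomm]
        rw [lintegral_const_mul' _ _ ENNReal.ofReal_ne_top,
          lintegral_beta_mul_beta (h := fun q => h (c * t * √(1 - q))) (by fun_prop),
          ENNReal.ofReal_mul (mul_nonneg hΓ (by positivity)), ENNReal.ofReal_mul hΓ, mul_assoc,
          mul_assoc]
        simp only [eulerLIntegral]
        -- With `b = n / 2` the Euler exponent gives the first hypergeometric parameter `n - a = d -
        -- 1 - a`.
        rw [show a - 2 * ((n : ℝ) / 2) = -(n - a) by ring]

/-! ### The claimed density and the comparison of laws. -/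

/-- The radial profile of the density `p₁(·, t)`, where `R = ct` and `d = n + 1`. -/
noncomputable def radialDensity (n : ℕ) (a R r : ℝ) : ℝ≥0∞ :=
  (Set.Iio R).indicator (fun r => ENNReal.ofReal
    (1 / (2 ^ (2 * a - n) * Real.pi ^ (((n + 1 : ℕ) : ℝ) / 2)) *
      (Real.Gamma (((n + 1 : ℕ) : ℝ) / 2) * Real.Gamma (2 * a) / Real.Gamma a ^ 2) *
      (Real.Gamma (((n + 1 : ℕ) : ℝ) / 2) / (√Real.pi * Real.Gamma ((n : ℝ) / 2))) *
      ((R ^ 2 - r ^ 2) ^ ((n : ℝ) / 2 - 1) / R ^ (2 * (n : ℝ) - 1))) *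
    eulerLIntegral (n - a) (n / 2) (r ^ 2 / R ^ 2)) r

theorem measurable_radialDensity (n : ℕ) (a R : ℝ) : Measurable (radialDensity n a R) := by
  have := measurable_eulerLIntegral (n - a) (n / 2)
  exact Measurable.indicator (by fun_prop) measurableSet_Iio

theorem lintegral_norm_withDensity {n : ℕ} (hn : n ≠ 0) {a R : ℝ} (ha : 0 < a) (hR : 0 < R)
    {h : ℝ → ℝ≥0∞} (hh : Measurable h) :
    ∫⁻ x, h ‖x‖ ∂(volume.withDensity
        fun x : EuclideanSpace ℝ (Fin (n + 1)) => radialDensity n a R ‖x‖) =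
      ENNReal.ofReal (Real.Gamma (2 * a) / Real.Gamma a ^ 2 * (2 * 4 ^ (-a)) * axialConst n) *
        ∫⁻ q in Set.Ioo (0 : ℝ) 1,
          ENNReal.ofReal (q ^ ((n : ℝ) / 2 - 1) * (1 - q) ^ ((n : ℝ) / 2 - 1 / 2)) *
            (eulerLIntegral (n - a) (n / 2) (1 - q) * h (R * √(1 - q))) := by
  have hm := measurable_radialDensity n a R
  have h1 := Real.Gamma_pos_of_pos (show 0 < ((n + 1 : ℕ) : ℝ) / 2 by positivity)
  have h2 := Real.Gamma_pos_of_pos (show 0 < (n : ℝ) / 2 by positivity)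
  have h3 := Real.Gamma_pos_of_pos (show 0 < 2 * a by positivity)
  have h4 := Real.Gamma_pos_of_pos ha
  set C : ℝ := 1 / (2 ^ (2 * a - n) * Real.pi ^ (((n + 1 : ℕ) : ℝ) / 2)) *
      (Real.Gamma (((n + 1 : ℕ) : ℝ) / 2) * Real.Gamma (2 * a) / Real.Gamma a ^ 2) *
      (Real.Gamma (((n + 1 : ℕ) : ℝ) / 2) / (√Real.pi * Real.Gamma ((n : ℝ) / 2))) with hC
  have hC0 : 0 ≤ C := by positivity
  -- On the right stand the area of the unit sphere and the factor `1 / 2` of `lintegral_radial`;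
  -- the powers of two match because `4 ^ a = 2 ^ (2 * a)`.
  have hconst : Real.Gamma (2 * a) / Real.Gamma a ^ 2 * (2 * 4 ^ (-a)) * axialConst n =
      2 * Real.pi ^ (((n + 1 : ℕ) : ℝ) / 2) / Real.Gamma (((n + 1 : ℕ) : ℝ) / 2) *
        (C * (1 / 2)) := by
    obtain ⟨m, rfl⟩ := Nat.exists_eq_succ_of_ne_zero hn
    rw [hC, axialConst, Real.rpow_sub two_pos, Real.rpow_mul zero_le_two, Real.rpow_natCast,
      Real.rpow_neg (by norm_num), Nat.succ_sub_one, pow_succ]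
    norm_num
    field_simp
    ring
  clear_value C
  rw [lintegral_withDensity_eq_lintegral_mul _ (by fun_prop) (by fun_prop)]
  refine (lintegral_fun_norm volume (f := fun r => radialDensity n a R r * h r)
    (by fun_prop)).trans ?_
  rw [toSphere_univ_eq n.succ_ne_zero, hconst, ENNReal.ofReal_mul (by positivity),
    ENNReal.ofReal_mul hC0, mul_assoc, mul_assoc, ← lintegral_radial hR]
  congr 1
  rw [← lintegral_const_mul' _ _ ENNReal.ofReal_ne_top, ← lintegral_indicator measurableSet_Ioi,
    ← lintegral_indicator measurableSet_Ioo]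
  refine lintegral_congr fun r => ?_
  by_cases hr : r ∈ Set.Ioo 0 R
  · have hr0 : 0 < r := hr.1
    have hd : 0 < R ^ 2 - r ^ 2 := by nlinarith [hr.1, hr.2]
    rw [Set.indicator_of_mem (show r ∈ Set.Ioi 0 from hr.1), Set.indicator_of_mem hr,
      radialDensity, Set.indicator_of_mem (show r ∈ Set.Iio R from hr.2), ← hC]
    have hsq : R * √(r ^ 2 / R ^ 2) = r := by
      rw [← div_pow, Real.sqrt_sq (by positivity), mul_div_cancel₀ _ hR.ne']
    simp only [sub_sub_cancel, hsq, finrank_euclideanSpace_fin, Nat.add_sub_cancel]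
    rw [ENNReal.ofReal_mul hC0, ENNReal.ofReal_mul (pow_nonneg hr0.le n)]
    ring
  · rw [Set.indicator_of_notMem hr]
    by_cases hr0 : 0 < r
    · have hrR : r ∉ Set.Iio R := fun h => hr ⟨hr0, h⟩
      simp [radialDensity, Set.indicator_of_notMem hrR]
    · simp [Set.indicator, hr0]

theorem indicator_ball_density_eq {n : ℕ} (hn : n ≠ 0) {a c t : ℝ} (ha : 0 < a) (hc : 0 < c)
    (ht : 0 < t) :
    ((Metric.ball (0 : EuclideanSpace ℝ (Fin (n + 1))) (c * t)).indicator fun x =>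
      ENNReal.ofReal
        (1 / (2 ^ (2 * a - (n + 1 : ℕ) + 1) * Real.pi ^ (((n + 1 : ℕ) : ℝ) / 2)) *
          (Real.Gamma (((n + 1 : ℕ) : ℝ) / 2) * Real.Gamma (2 * a) / Real.Gamma a ^ 2) *
          ((c ^ 2 * t ^ 2 - ‖x‖ ^ 2) ^ ((((n + 1 : ℕ) : ℝ) - 3) / 2) /
            (c * t) ^ (2 * ((n + 1 : ℕ) : ℝ) - 3)) *
          hyp2F1 ((n + 1 : ℕ) - 1 - a) (1 / 2) (((n + 1 : ℕ) : ℝ) / 2)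
            (‖x‖ ^ 2 / (c ^ 2 * t ^ 2)))) =
      fun x => radialDensity n a (c * t) ‖x‖ := by
  have hR : 0 < c * t := mul_pos hc ht
  ext x
  by_cases hx : ‖x‖ < c * t
  swap
  · rw [Set.indicator_of_notMem (by simpa using hx), radialDensity,
      Set.indicator_of_notMem (by simpa using hx)]
  have hx2 : ‖x‖ ^ 2 < (c * t) ^ 2 := pow_lt_pow_left₀ hx (norm_nonneg _) two_ne_zero
  have hd : 0 < (c * t) ^ 2 - ‖x‖ ^ 2 := sub_pos.2 hx2
  have hn1 : (1 : ℝ) ≤ n := by exact_mod_cast Nat.one_le_iff_ne_zero.2 hn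
  have h1 := Real.Gamma_pos_of_pos (show 0 < ((n + 1 : ℕ) : ℝ) / 2 by positivity)
  have h2 := Real.Gamma_pos_of_pos (show 0 < (n : ℝ) / 2 by positivity)
  have h3 := Real.Gamma_pos_of_pos (show 0 < 2 * a by positivity)
  have h4 := Real.Gamma_pos_of_pos ha
  rw [Set.indicator_of_mem (by simpa using hx), radialDensity,
    Set.indicator_of_mem (show ‖x‖ ∈ Set.Iio (c * t) from hx), ← mul_pow,
    show 2 * a - (n + 1 : ℕ) + 1 = 2 * a - n by push_cast; ring,
    show (((n + 1 : ℕ) : ℝ) - 3) / 2 = n / 2 - 1 by push_cast; ring,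
    show 2 * ((n + 1 : ℕ) : ℝ) - 3 = 2 * n - 1 by push_cast; ring,
    show ((n + 1 : ℕ) : ℝ) - 1 - a = n - a by push_cast; ring,
    ENNReal.ofReal_mul (by positivity),
    ofReal_hyp2F1 (by push_cast; linarith) (by positivity) ((div_lt_one (by positivity)).2 hx2),
    show ((n + 1 : ℕ) : ℝ) / 2 - 1 / 2 = n / 2 by push_cast; ring, ← mul_assoc,
    ← ENNReal.ofReal_mul (by positivity)]
  congr 2
  ring

theorem position_law_eq {n : ℕ} (hn : n ≠ 0) {a c t : ℝ} (ha : 0 < a) (hc : 0 < c) (ht : 0 < t)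
    [IsFiniteMeasure (gdLaw (fun _ : Fin 1 => a) (fun _ => a) t)] :
    ((((gdLaw (fun _ : Fin 1 => a) (fun _ => a) t).map fun s => s 0).prod
        ((uniformSphere (n + 1)).prod (uniformSphere (n + 1)))).map
          fun p => c • (p.1 • p.2.1 + (t - p.1) • p.2.2)) =
      volume.withDensity fun x => radialDensity n a (c * t) ‖x‖ := by
  have hnorm : ((((gdLaw (fun _ : Fin 1 => a) (fun _ => a) t).map fun s => s 0).prod
        ((uniformSphere (n + 1)).prod (uniformSphere (n + 1)))).map
          fun p => c • (p.1 • p.2.1 + (t - p.1) • p.2.2)).map norm =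
      (volume.withDensity fun x : EuclideanSpace ℝ (Fin (n + 1)) =>
        radialDensity n a (c * t) ‖x‖).map norm := by
    refine Measure.ext_of_lintegral _ fun h hh => ?_
    rw [lintegral_map hh measurable_norm, lintegral_map hh measurable_norm,
      lintegral_norm_position_law hn ha hc ht hh,
      lintegral_norm_withDensity hn ha (mul_pos hc ht) hh]
  -- Finiteness is inherited from the position law through the equality of norm laws, without
  -- integrating the density.
  have hfin : IsFiniteMeasure (volume.withDensity fun x : EuclideanSpace ℝ (Fin (n + 1)) =>
      radialDensity n a (c * t) ‖x‖) := by
    refine ⟨?_⟩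
    have := measure_lt_top (((((gdLaw (fun _ : Fin 1 => a) (fun _ => a) t).map fun s => s 0).prod
        ((uniformSphere (n + 1)).prod (uniformSphere (n + 1)))).map
          fun p => c • (p.1 • p.2.1 + (t - p.1) • p.2.2)).map norm) Set.univ
    rwa [hnorm, Measure.map_apply measurable_norm .univ, Set.preimage_univ] at this
  refine ext_of_map_norm_eq (fun ρ => ?_)
    (withDensity_norm_map (measurable_radialDensity n a (c * t))) hnorm
  have hρ : Measurable ρ := ρ.continuous.measurable
  -- Rotating both directions by the same `ρ` preserves their joint law and, by linearity, rotates
  -- the position.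
  conv_rhs => rw [← uniformSphere_map ρ, Measure.map_prod_map _ _ hρ hρ]
  conv_rhs => rw [← Measure.map_id (μ := Measure.map (fun s : Fin 1 → ℝ => s 0) _),
    Measure.map_prod_map _ _ measurable_id (by fun_prop)]
  rw [Measure.map_map hρ (by fun_prop), Measure.map_map (by fun_prop) (by fun_prop)]
  congr 1
  ext1 p
  simp

end RandomFlight

theorem mainTheorem6 {Ω : Type*} [MeasurableSpace Ω] (P : Measure Ω) [IsProbabilityMeasure P]
    (d : ℕ) (hd : 2 ≤ d) (a c t : ℝ) (ha : 0 < a) (hc : 0 < c) (ht : 0 < t)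
    (V : ℕ → Ω → EuclideanSpace ℝ (Fin d)) (τ : ℕ → Ω → ℝ)
    (hflight : RandomFlight.IsRandomFlight P d 1 (fun _ => a) (fun _ => a) t V τ) :
    (P[|{ω | RandomFlight.numTurns (fun k => τ k ω) t = 1}]).map
        (fun ω => RandomFlight.position c (fun k => V k ω) (fun k => τ k ω) t) =
      volume.withDensity
        ((Metric.ball (0 : EuclideanSpace ℝ (Fin d)) (c * t)).indicator fun x =>
          ENNReal.ofReal
            (1 / (2 ^ (2 * a - d + 1) * Real.pi ^ ((d : ℝ) / 2)) *
              (Real.Gamma ((d : ℝ) / 2) * Real.Gamma (2 * a) / Real.Gamma a ^ 2) *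
              ((c ^ 2 * t ^ 2 - ‖x‖ ^ 2) ^ (((d : ℝ) - 3) / 2) / (c * t) ^ (2 * (d : ℝ) - 3)) *
              RandomFlight.hyp2F1 (d - 1 - a) (1 / 2) ((d : ℝ) / 2)
                (‖x‖ ^ 2 / (c ^ 2 * t ^ 2)))) := by
  obtain ⟨n, rfl⟩ : ∃ n, d = n + 1 := ⟨d - 1, by omega⟩
  have hn : n ≠ 0 := by omega
  -- As the image of a conditional measure, `gdLaw` is finite without evaluating the Beta integral.
  have : IsFiniteMeasure (RandomFlight.gdLaw (fun _ : Fin 1 => a) (fun _ => a) t) := by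
    rw [← hflight.waiting_law]
    infer_instance
  rw [hflight.map_position, RandomFlight.position_law_eq hn ha hc ht,
    RandomFlight.indicator_ball_density_eq hn ha hc ht]
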